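/- Let $\Gamma$ be a finitely generated hyperbolic group that is non-elementary, i.e. not virtually cyclic. Let $\partial\Gamma$ be its Gromov boundary, defined with respect to a finite generating set whose word metric is hyperbolic, and let $\tau_G$ be the topology of the Gromov compactification on the disjoint union $\Gamma\cup\partial\Gamma$, on which $\Gamma$ acts by left multiplication on $\Gamma$ and by its natural action on $\partial\Gamma$. For a compact metrizable $\Gamma$-space $X$ with minimal action, a topology $\tau$ on the disjoint union $\Gamma\cup X$ is called a $\Gamma$-compactification if it is compact and Hausdorff, $\Gamma$ is dense, $\tau$ induces the discrete topology on $\Gamma$ and the given topology on $X$, and $\Gamma$ acts continuously on $(\Gamma\cup X,\tau)$. For a Borel probability measure $\nu$ on $X$, let $\tau_\nu$ be the topology on $\Gamma\cup X$ in which a set $A$ is closed if and only if $A\cap X$ is closed in $X$ and, for every sequence $(\gamma_n)$ in $A\cap\Gamma$ that leaves every finite subset of $\Gamma$, $A$ contains every $x\in X$ such that $\delta_x$ is a weak* accumulation point of $(\gamma_n\nu)$. (Thus, for a sequence $(\gamma_n)$ in $\Gamma$ that leaves every finite set, $\gamma_n\to x\in X$ in $\tau_\nu$ if and only if $\gamma_n\nu\to\delta_x$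 weak*.) A $\Gamma$-compactification $\tau$ is called orbital if $\tau=\tau_\nu$ for some Borel probability measure $\nu$ on $X$, and point-orbital if $\tau=\tau_{\delta_{x_0}}$ for some $x_0\in X$. Then: 1. $\tau_G$ is an orbital $\Gamma$-compactification (with $X=\partial\Gamma$); 2. $\tau_G=\tau_\nu$ for every Borel probability measure $\nu$ on $\partial\Gamma$ without atoms; 3. $\tau_G$ is not point-orbital; 4. there is no $\Gamma$-equivariant retraction onto the boundary, i.e. no continuous $\Gamma$-equivariant map $\varphi\colon(\Gamma\cup\partial\Gamma,\tau_G)\to\partial\Gamma$ with $\varphi(x)=x$ for all $x\in\partial\Gamma$. -/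

import Mathlib

open Filter Topology MeasureTheory

noncomputable section

namespace GromovCompactification

/-! ### Word metrics, Gromov products and hyperbolic groups -/

section WordMetric

variable {Γ : Type*} [Group Γ]

/-- The word length of `g` with respect to `S`: the least length of a word in the letters
`S ∪ S⁻¹` that represents `g`. -/
def wordLength (S : Set Γ) (g : Γ) : ℕ :=
  sInf {n | ∃ l : List Γ, (∀ s ∈ l, s ∈ S ∨ s⁻¹ ∈ S) ∧ l.prod = g ∧ l.length = n}

/-- The left-invariant word metric `d(x, y) = |x⁻¹ y|`. -/
def wordDist (S : Set Γ) (x y : Γ) : ℕ := wordLength S (x⁻¹ * y)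

/-- The Gromov product `⟨x, y⟩_w = (d(w, x) + d(w, y) - d(x, y)) / 2` of the word metric. -/
def gromovProduct (S : Set Γ) (w x y : Γ) : ℝ :=
  ((wordDist S w x : ℝ) + wordDist S w y - wordDist S x y) / 2

/-- Gromov's four-point hyperbolicity condition for the word metric. -/
def IsHyperbolic (S : Set Γ) : Prop :=
  ∃ δ : ℝ, ∀ w x y z : Γ,
    min (gromovProduct S w x y) (gromovProduct S w y z) - δ ≤ gromovProduct S w x z

end WordMetric

/-- A finite generating set of `Γ` whose word metric is hyperbolic. The group `Γ` is a (finitely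
generated) hyperbolic group if and only if it has one. -/
structure HyperbolicGeneratingSet (Γ : Type*) [Group Γ] where
  carrier : Set Γ
  finite : carrier.Finite
  closure_eq_top : Subgroup.closure carrier = ⊤
  hyperbolic : IsHyperbolic carrier

/-- A hyperbolic group is elementary if it is virtually cyclic (finite groups included). -/
def IsElementary (Γ : Type*) [Group Γ] : Prop :=
  ∃ H : Subgroup Γ, H.FiniteIndex ∧ IsCyclic H

section Basic

variable {Γ : Type*} [Group Γ] (S : HyperbolicGeneratingSet Γ)

theorem exists_word (g : Γ) : ∃ l : List Γ, (∀ s ∈ l, s ∈ S.carrier ∨ s⁻¹ ∈ S.carrier) ∧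
    l.prod = g ∧ l.length = wordLength S.carrier g := by
  have hg : g ∈ Submonoid.closure (S.carrier ∪ S.carrier⁻¹) := by
    rw [← Subgroup.closure_toSubmonoid, S.closure_eq_top]; trivial
  obtain ⟨l, hl, hp⟩ := Submonoid.exists_list_of_mem_closure hg
  exact Nat.sInf_mem (s := {n | ∃ l : List Γ, (∀ s ∈ l, s ∈ S.carrier ∨ s⁻¹ ∈ S.carrier) ∧
    l.prod = g ∧ l.length = n}) ⟨l.length, l, hl, hp, rfl⟩

theorem wordLength_mul_le (g h : Γ) : wordLength S.carrier (g * h) ≤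
    wordLength S.carrier g + wordLength S.carrier h := by
  obtain ⟨l, hl, hp, hn⟩ := exists_word S g
  obtain ⟨l', hl', hp', hn'⟩ := exists_word S h
  refine Nat.sInf_le ⟨l ++ l', ?_, by simp [hp, hp'], by simp [hn, hn']⟩
  intro s hs
  rcases List.mem_append.1 hs with hs | hs
  exacts [hl s hs, hl' s hs]

theorem wordLength_inv_le (g : Γ) :
    wordLength S.carrier g⁻¹ ≤ wordLength S.carrier g := by
  obtain ⟨l, hl, hp, hn⟩ := exists_word S g
  refine Nat.sInf_le ⟨(l.map (fun x => x⁻¹)).reverse, ?_, ?_, by simp [hn]⟩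
  · intro s hs
    simp only [List.mem_reverse, List.mem_map] at hs
    obtain ⟨a, ha, rfl⟩ := hs
    simpa [or_comm] using hl a ha
  · rw [← hp, List.prod_inv_reverse]

theorem wordDist_comm (x y : Γ) : wordDist S.carrier x y = wordDist S.carrier y x := by
  have h : ∀ a b : Γ, wordDist S.carrier a b ≤ wordDist S.carrier b a := fun a b => by
    simpa [wordDist] using wordLength_inv_le S (b⁻¹ * a)
  exact le_antisymm (h x y) (h y x)

theorem wordDist_triangle (x y z : Γ) :
    wordDist S.carrier x z ≤ wordDist S.carrier x y + wordDist S.carrier y z := by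
  simpa [wordDist, mul_assoc] using wordLength_mul_le S (x⁻¹ * y) (y⁻¹ * z)

theorem gromovProduct_comm (w x y : Γ) :
    gromovProduct S.carrier w x y = gromovProduct S.carrier w y x := by
  simp only [gromovProduct, wordDist_comm S x y]; ring

/-- Left translation changes Gromov products based at `1` by a bounded amount. -/
theorem gromovProduct_le_mul (g x y : Γ) : gromovProduct S.carrier 1 x y - wordLength S.carrier g
    ≤ gromovProduct S.carrier 1 (g * x) (g * y) := by
  have key : ∀ x : Γ, (wordDist S.carrier 1 x : ℝ) ≤
      wordLength S.carrier g + wordDist S.carrier 1 (g * x) := fun x => by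
    have h := wordLength_mul_le S g⁻¹ (g * x)
    have h' := wordLength_inv_le S g
    simp only [wordDist, inv_one, one_mul, inv_mul_cancel_left] at h ⊢
    exact_mod_cast h.trans (by omega)
  have hd : wordDist S.carrier (g * x) (g * y) = wordDist S.carrier x y := by
    simp [wordDist, mul_assoc]
  have hx := key x
  have hy := key y
  simp only [gromovProduct, hd]
  linarith

/-- The sequences `x` in `Γ` that converge to infinity: `⟨x i, x j⟩ → ∞` as `i, j → ∞`. -/
def ConvergesToInfinity (x : ℕ → Γ) : Prop :=
  Tendsto (fun n : ℕ × ℕ => gromovProduct S.carrier 1 (x n.1) (x n.2)) atTop atTop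

/-- Two sequences converging to infinity are equivalent if `⟨x i, y j⟩ → ∞` as `i, j → ∞`. -/
def boundarySetoid : Setoid {x : ℕ → Γ // ConvergesToInfinity S x} where
  r x y := Tendsto (fun n : ℕ × ℕ => gromovProduct S.carrier 1 (x.1 n.1) (y.1 n.2)) atTop atTop
  iseqv := by
    refine ⟨fun x => x.2, fun {x y} h => ?_, fun {x y z} hxy hyz => ?_⟩
    · have hs : Tendsto (Prod.swap : ℕ × ℕ → ℕ × ℕ) atTop atTop := by
        rw [← prod_atTop_atTop_eq]; exact tendsto_prod_swap
      refine (h.comp hs).congr fun n => ?_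
      exact gromovProduct_comm S _ _ _
    · obtain ⟨δ, hδ⟩ := S.hyperbolic
      have hd : Tendsto (fun n : ℕ × ℕ => (n.1, n.1)) atTop atTop := by
        rw [← prod_atTop_atTop_eq]; exact tendsto_fst.prodMk tendsto_fst
      have h1 := hxy.comp hd
      refine tendsto_atTop.2 fun b => ?_
      filter_upwards [tendsto_atTop.1 h1 (b + δ), tendsto_atTop.1 hyz (b + δ)] with n h1 h2
      have h3 := hδ 1 (x.1 n.1) (y.1 n.1) (z.1 n.2)
      have h4 := le_min h1 h2
      simp only [Function.comp] at h4
      linarith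

/-- The Gromov boundary `∂Γ`: equivalence classes of sequences converging to infinity. -/
def Boundary : Type _ := Quotient (boundarySetoid S)

variable {S} in
theorem ConvergesToInfinity.mul {x : ℕ → Γ} (hx : ConvergesToInfinity S x) (g : Γ) :
    ConvergesToInfinity S (fun n => g * x n) :=
  tendsto_atTop_mono (fun _ => gromovProduct_le_mul S g _ _)
    (tendsto_atTop_add_const_right atTop _ hx)

/-- The action of `Γ` on its boundary, `g • [x] = [n ↦ g * x n]`. -/
instance instMulActionBoundary : MulAction Γ (Boundary S) where
  smul g := Quotient.map (sa := boundarySetoid S) (sb := boundarySetoid S)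
    (fun x => ⟨fun n => g * x.1 n, x.2.mul g⟩) fun _ _ h =>
      tendsto_atTop_mono (fun _ => gromovProduct_le_mul S g _ _)
        (tendsto_atTop_add_const_right atTop _ h)
  one_smul := by
    rintro ⟨x⟩
    exact congrArg (Quotient.mk (boundarySetoid S)) (Subtype.ext (funext fun n => one_mul _))
  mul_smul := by
    rintro g h ⟨x⟩
    exact congrArg (Quotient.mk (boundarySetoid S)) (Subtype.ext (funext fun n => mul_assoc _ _ _))

/-! ### The Gromov compactification

The set `Γ ∪ ∂Γ` is the disjoint union `Γ ⊕ Boundary S`, with the action of `Γ` by left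
multiplication on the first summand and by the action above on the second one. -/

/-- The sequences in `Γ` that represent a point of `Γ ∪ ∂Γ`: the constant sequence for a point of
`Γ`, the members of the equivalence class for a point of `∂Γ`. -/
def Represents (x : ℕ → Γ) : Γ ⊕ Boundary S → Prop
  | Sum.inl g => ∀ n, x n = g
  | Sum.inr ξ => ∃ hx : ConvergesToInfinity S x, Quotient.mk (boundarySetoid S) ⟨x, hx⟩ = ξ

/-- The Gromov product, based at the identity, extended to `Γ ∪ ∂Γ`:
`⟨p, q⟩ = sup liminf_{i, j → ∞} ⟨x i, y j⟩` over all sequences `x`, `y` representing `p`, `q`. -/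
def extProduct (p q : Γ ⊕ Boundary S) : EReal :=
  ⨆ (x : ℕ → Γ) (y : ℕ → Γ) (_ : Represents S x p) (_ : Represents S y q),
    liminf (fun n : ℕ × ℕ => ((gromovProduct S.carrier 1 (x n.1) (y n.2) : ℝ) : EReal)) atTop

/-- The topology of the Gromov compactification `Γ ∪ ∂Γ`: the points of `Γ` are isolated, and
the sets `{p | ⟨ξ, p⟩ > r}`, for real `r`, are a neighbourhood base at `ξ ∈ ∂Γ`. -/
def gromovTopology : TopologicalSpace (Γ ⊕ Boundary S) where
  IsOpen U := ∀ ξ : Boundary S, Sum.inr ξ ∈ U →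
    ∃ r : ℝ, ∀ p, (r : EReal) < extProduct S (Sum.inr ξ) p → p ∈ U
  isOpen_univ := fun _ _ => ⟨0, fun _ _ => trivial⟩
  isOpen_inter := by
    intro U V hU hV ξ hξ
    obtain ⟨r, hr⟩ := hU ξ hξ.1
    obtain ⟨s, hs⟩ := hV ξ hξ.2
    refine ⟨max r s, fun p hp => ⟨hr p (lt_of_le_of_lt ?_ hp), hs p (lt_of_le_of_lt ?_ hp)⟩⟩
    · exact_mod_cast le_max_left r s
    · exact_mod_cast le_max_right r s
  isOpen_sUnion := by
    intro 𝒰 h𝒰 ξ ⟨U, hU, hξ⟩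
    obtain ⟨r, hr⟩ := h𝒰 U hU ξ hξ
    exact ⟨r, fun p hp => ⟨U, hU, hr p hp⟩⟩

/-- The Gromov boundary with the subspace topology. -/
instance instTopologicalSpaceBoundary : TopologicalSpace (Boundary S) :=
  (gromovTopology S).induced Sum.inr

instance instMeasurableSpaceBoundary : MeasurableSpace (Boundary S) := borel _

instance instBorelSpaceBoundary : BorelSpace (Boundary S) := ⟨rfl⟩

variable {S} in
theorem Represents.mul {x : ℕ → Γ} {p : Γ ⊕ Boundary S} (h : Represents S x p) (g : Γ) :
    Represents S (fun n => g * x n) (g • p) := by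
  rcases p with a | ξ
  · intro n
    change g * x n = g * a
    rw [h n]
  · obtain ⟨hx, rfl⟩ := h
    exact ⟨hx.mul g, rfl⟩

theorem extProduct_smul (g : Γ) (r : ℝ) (p q : Γ ⊕ Boundary S)
    (h : ((r + wordLength S.carrier g : ℝ) : EReal) < extProduct S p q) :
    (r : EReal) < extProduct S (g • p) (g • q) := by
  simp only [extProduct, lt_iSup_iff] at h ⊢
  obtain ⟨x, y, hx, hy, h⟩ := h
  refine ⟨_, _, hx.mul g, hy.mul g, ?_⟩
  obtain ⟨c, hc, hc'⟩ := EReal.lt_iff_exists_real_btwn.1 h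
  have hrc : r < c - wordLength S.carrier g := by
    have := EReal.coe_lt_coe_iff.1 hc
    linarith
  refine lt_of_lt_of_le (EReal.coe_lt_coe_iff.2 hrc) (le_liminf_of_le ?_ ?_)
  · isBoundedDefault
  · filter_upwards [eventually_lt_of_lt_liminf hc'] with n hn
    have h1 := EReal.coe_lt_coe_iff.1 hn
    have h2 := gromovProduct_le_mul S g (x n.1) (y n.2)
    exact EReal.coe_le_coe_iff.2 (by linarith)

theorem continuous_smul_gromovTopology (g : Γ) :
    @Continuous _ _ (gromovTopology S) (gromovTopology S)
      (fun p : Γ ⊕ Boundary S => g • p) := by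
  refine @Continuous.mk _ _ (gromovTopology S) (gromovTopology S) _ ?_
  intro U hU ξ hξ
  obtain ⟨r, hr⟩ := hU (g • ξ) hξ
  refine ⟨r + wordLength S.carrier g, fun p hp => ?_⟩
  exact hr (g • p) (extProduct_smul S g r (Sum.inr ξ) p hp)

instance instContinuousConstSMulBoundary : ContinuousConstSMul Γ (Boundary S) where
  continuous_const_smul g := by
    refine ⟨fun U hU => ?_⟩
    obtain ⟨V, hV, rfl⟩ := hU
    exact ⟨_, @Continuous.isOpen_preimage _ _ (gromovTopology S) (gromovTopology S) _
      (continuous_smul_gromovTopology S g) V hV, rfl⟩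

end Basic

/-! ### Group compactifications and orbital topologies -/

section Orbital

variable {Γ X : Type*} [Group Γ] [TopologicalSpace X] [MulAction Γ X]

/-- A topology `τ` on the disjoint union `Γ ∪ X` of the discrete group `Γ` and of the compact
metrizable minimal `Γ`-space `X` is a `Γ`-compactification if it is compact and Hausdorff,
contains `Γ` as a dense subset, induces the original topologies on `Γ` and `X`, and the action of
`Γ` on `Γ ∪ X` is continuous. -/
structure IsGroupCompactification (τ : TopologicalSpace (Γ ⊕ X)) : Prop where
  compact_boundary : CompactSpace X
  metrizable_boundary : TopologicalSpace.MetrizableSpace X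
  minimal_boundary : MulAction.IsMinimal Γ X
  compact : @CompactSpace _ τ
  hausdorff : @T2Space _ τ
  dense : @DenseRange _ τ _ (Sum.inl : Γ → Γ ⊕ X)
  induced_group : τ.induced Sum.inl = ⊥
  induced_boundary : τ.induced Sum.inr = ‹TopologicalSpace X›
  continuous_smul : ∀ g : Γ, @Continuous _ _ τ τ (fun p => g • p)

variable [ContinuousConstSMul Γ X] [MeasurableSpace X] [BorelSpace X]

/-- The translate `g ν` of a probability measure, `(g ν)(E) = ν(g⁻¹ E)`. -/
def translate (g : Γ) (ν : ProbabilityMeasure X) : ProbabilityMeasure X :=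
  ν.map (f := fun x => g • x) (continuous_const_smul g).measurable.aemeasurable

/-- The closed sets of the topology `τ_ν`: those `A ⊆ Γ ∪ X` such that `A ∩ X` is closed in `X`,
and such that, for every sequence `γ` in `A ∩ Γ` that leaves every finite subset of `Γ`, the set
`A` contains every `x : X` for which `δ_x` is a weak* accumulation point of `γ n ν`. -/
def IsOrbitalClosed (ν : ProbabilityMeasure X) (A : Set (Γ ⊕ X)) : Prop :=
  IsClosed (Sum.inr ⁻¹' A : Set X) ∧
    ∀ γ : ℕ → Γ, (∀ n, Sum.inl (γ n) ∈ A) → Tendsto γ atTop cofinite →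
      ∀ x : X, MapClusterPt (diracProba x) atTop (fun n => translate (γ n) ν) → Sum.inr x ∈ A

theorem IsOrbitalClosed.of_frequently {ν : ProbabilityMeasure X} {A : Set (Γ ⊕ X)}
    (hA : IsOrbitalClosed ν A) {γ : ℕ → Γ} (hγ : Tendsto γ atTop cofinite) {x : X}
    (hx : ClusterPt (diracProba x)
      (map (fun n => translate (γ n) ν) (atTop ⊓ 𝓟 {n | Sum.inl (γ n) ∈ A}))) :
    Sum.inr x ∈ A := by
  have hne : (atTop ⊓ 𝓟 {n | Sum.inl (γ n) ∈ A} : Filter ℕ).NeBot := by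
    by_contra h
    rw [not_neBot] at h
    rw [h, map_bot] at hx
    exact hx.ne (by simp)
  have hfr : ∃ᶠ n in atTop, Sum.inl (γ n) ∈ A := frequently_iff_neBot.2 hne
  choose k hk hkA using frequently_atTop.1 hfr
  classical
  let m : ℕ → ℕ := fun n => if Sum.inl (γ n) ∈ A then n else k n
  have hm : ∀ n, n ≤ m n := fun n => by
    dsimp only [m]; split_ifs
    exacts [le_rfl, hk n]
  have hmA : ∀ n, Sum.inl (γ (m n)) ∈ A := fun n => by
    dsimp only [m]; split_ifs with h
    exacts [h, hkA n]
  refine hA.2 (fun n => γ (m n)) hmA (hγ.comp (tendsto_atTop_mono hm tendsto_id)) x ?_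
  refine ClusterPt.mono hx ?_
  have he : map (fun n => translate (γ n) ν) (atTop ⊓ 𝓟 {n | Sum.inl (γ n) ∈ A}) =
      map (fun n => translate (γ (m n)) ν) (atTop ⊓ 𝓟 {n | Sum.inl (γ n) ∈ A}) := by
    refine map_congr ?_
    filter_upwards [mem_inf_of_right (mem_principal_self _)] with n hn
    have : m n = n := if_pos hn
    rw [this]
  rw [he]
  exact map_mono inf_le_left

/-- The topology `τ_ν` on `Γ ∪ X`: a sequence in `Γ` that leaves every finite subset of `Γ`
converges to `x : X` if and only if its translates of `ν` converge weak* to `δ_x`. -/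
def orbitalTopology (ν : ProbabilityMeasure X) : TopologicalSpace (Γ ⊕ X) :=
  TopologicalSpace.ofClosed {A | IsOrbitalClosed ν A}
    ⟨by simp, fun γ h => (h 0).elim⟩
    (by
      intro 𝒜 h𝒜
      refine ⟨?_, fun γ hγ hγ' x hx A hA => ?_⟩
      · rw [Set.preimage_sInter]
        exact isClosed_biInter fun A hA => (h𝒜 hA).1
      · exact (h𝒜 hA).2 γ (fun n => hγ n A hA) hγ' x hx)
    (by
      intro A hA B hB
      refine ⟨hA.1.union hB.1, fun γ hγ hγ' x hx => ?_⟩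
      have hle : (atTop : Filter ℕ) ≤
          atTop ⊓ 𝓟 {n | Sum.inl (γ n) ∈ A} ⊔ atTop ⊓ 𝓟 {n | Sum.inl (γ n) ∈ B} := by
        rw [← inf_sup_left, sup_principal]
        exact le_inf le_rfl (le_principal_iff.2 (univ_mem' hγ))
      have hx' := ClusterPt.mono hx (map_mono (m := fun n => translate (γ n) ν) hle)
      rw [map_sup, clusterPt_sup] at hx'
      rcases hx' with h | h
      · exact Or.inl (hA.of_frequently hγ' h)
      · exact Or.inr (hB.of_frequently hγ' h))

/-- `τ` is the orbital compactification defined by `ν`: it is a `Γ`-compactification, and it is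
the topology `τ_ν`. -/
def IsOrbitalBy (τ : TopologicalSpace (Γ ⊕ X)) (ν : ProbabilityMeasure X) : Prop :=
  IsGroupCompactification τ ∧ τ = orbitalTopology ν

/-- Orbital compactifications. -/
def IsOrbital (τ : TopologicalSpace (Γ ⊕ X)) : Prop :=
  ∃ ν : ProbabilityMeasure X, IsOrbitalBy τ ν

/-- Point-orbital compactifications: the orbital ones defined by a Dirac measure. -/
def IsPointOrbital (τ : TopologicalSpace (Γ ⊕ X)) : Prop :=
  ∃ x₀ : X, IsOrbitalBy τ (diracProba x₀)

/-- A `Γ`-equivariant continuous retraction of `(Γ ∪ X, τ)` onto `X`. -/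
def IsEquivariantRetraction (τ : TopologicalSpace (Γ ⊕ X)) (φ : Γ ⊕ X → X) : Prop :=
  @Continuous _ _ τ _ φ ∧ (∀ x : X, φ (Sum.inr x) = x) ∧
    ∀ (g : Γ) (p : Γ ⊕ X), φ (g • p) = g • φ p

end Orbital

end GromovCompactification

end

namespace GromovCompactification

/-! ### The word metric -/

section Word

variable {Γ : Type*} [Group Γ] (S : HyperbolicGeneratingSet Γ)

/-! Everything rests on convergence dynamics (`tendsto_smul_of_ne`): if `γ n → ζ` and `(γ n)⁻¹ → η`
in the Gromov compactification, then `γ n • z → ζ` for every boundary point `z ≠ η`. A measure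
without atoms does not see `η`, so by dominated convergence its translates tend to `δ_ζ`. With
compactness and metrizability of `Γ ∪ ∂Γ`, this identifies the closed sets of `τ_G` with those of
`τ_ν`.

The exceptional point is what defeats Dirac measures and retractions. Every `x₀` is conical
(`exists_tendsto_smul_ne`): moving back along a ray to `x₀` gives `γ n → ξ` with `γ n • x₀ → ζ ≠ ξ`.
So orbit points do not detect `τ_G`, and an equivariant `φ`, being determined on `Γ` by `φ 1`,
cannot be continuous and fix the boundary.

Non-elementarity gives minimality and a measure without atoms. Both follow from
`isElementary_of_finiteIndex_stabilizer`, proved with a Busemann function, which is a quasimorphism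
on the stabilizer of its boundary point. Without finite orbits the boundary is minimal and perfect,
hence uncountable, and carries a copy of Lebesgue measure. -/

theorem wordDist_self (x : Γ) : wordDist S.carrier x x = 0 :=
  Nat.sInf_eq_zero.2 (Or.inl ⟨[], by simp, by simp, rfl⟩)

theorem wordDist_mul_left (g x y : Γ) :
    wordDist S.carrier (g * x) (g * y) = wordDist S.carrier x y := by
  simp [wordDist, mul_assoc]

theorem wordDist_one_left (x : Γ) : wordDist S.carrier 1 x = wordLength S.carrier x := by
  simp [wordDist]

/-- The points on a geodesic from `1` to `g`. -/
theorem exists_prefix (g : Γ) {n : ℕ} (hn : n ≤ wordDist S.carrier 1 g) :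
    ∃ h : Γ, wordDist S.carrier 1 h = n ∧ n + wordDist S.carrier h g = wordDist S.carrier 1 g := by
  rw [wordDist_one_left] at hn
  obtain ⟨l, hl, hp, hlen⟩ := exists_word S g
  have h1 : wordLength S.carrier (l.take n).prod ≤ n := by
    refine Nat.sInf_le ⟨l.take n, fun s hs => hl s (List.mem_of_mem_take hs), rfl, ?_⟩
    rw [List.length_take]; omega
  have h2 : wordDist S.carrier (l.take n).prod g ≤ wordLength S.carrier g - n := by
    refine Nat.sInf_le ⟨l.drop n, fun s hs => hl s (List.mem_of_mem_drop hs), ?_, ?_⟩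
    · rw [← hp, ← List.prod_take_mul_prod_drop l n]; group
    · rw [List.length_drop, hlen]
  have h3 := wordDist_triangle S 1 (l.take n).prod g
  rw [wordDist_one_left, wordDist_one_left] at h3
  refine ⟨(l.take n).prod, ?_, ?_⟩ <;> rw [wordDist_one_left] <;> omega

theorem finite_ball (n : ℕ) : {g : Γ | wordDist S.carrier 1 g ≤ n}.Finite := by
  induction n with
  | zero =>
    refine (Set.finite_singleton (1 : Γ)).subset fun g hg => ?_
    rw [Set.mem_ofPred_eq, wordDist_one_left] at hg
    obtain ⟨l, -, hp, hlen⟩ := exists_word S g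
    have : l = [] := List.length_eq_zero_iff.1 (by omega)
    rw [Set.mem_singleton_iff, ← hp, this, List.prod_nil]
  | succ n ih =>
    have hfin : (insert 1 (S.carrier ∪ S.carrier⁻¹)).Finite :=
      (S.finite.union S.finite.inv).insert 1
    refine (Set.Finite.image2 (fun a b => a * b) ih hfin).subset fun g hg => ?_
    rw [Set.mem_ofPred_eq] at hg
    rcases Nat.lt_or_ge n (wordDist S.carrier 1 g) with h | h
    · obtain ⟨a, ha, hag⟩ := exists_prefix S g h.le
      have h1 : wordDist S.carrier a g = 1 := by omega
      obtain ⟨l, hl, hp, hlen⟩ := exists_word S (a⁻¹ * g)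
      obtain ⟨s, rfl⟩ := List.length_eq_one_iff.1 (hlen.trans h1)
      refine ⟨a, ha.le, s, ?_, ?_⟩
      · simpa using Or.inr (hl s (by simp))
      · rw [List.prod_singleton] at hp
        simp [hp]
    · exact ⟨g, h, 1, by simp, mul_one g⟩

theorem tendsto_wordDist_cofinite :
    Tendsto (fun g : Γ => (wordDist S.carrier 1 g : ℝ)) cofinite atTop := by
  refine tendsto_natCast_atTop_atTop.comp (tendsto_atTop.2 fun n => ?_)
  refine ((finite_ball S n).subset fun g hg => ?_)
  simp only [Set.mem_compl_iff, Set.mem_ofPred_eq] at hg ⊢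
  omega

theorem tendsto_cofinite_iff {ι : Type*} {l : Filter ι} {γ : ι → Γ} :
    Tendsto γ l cofinite ↔ Tendsto (fun i => (wordDist S.carrier 1 (γ i) : ℝ)) l atTop := by
  refine ⟨fun h => (tendsto_wordDist_cofinite S).comp h, fun h => ?_⟩
  intro s hs
  obtain ⟨n, hn⟩ := ((mem_cofinite.1 hs).image (wordDist S.carrier 1)).bddAbove
  rw [mem_map]
  filter_upwards [h.eventually_gt_atTop (n : ℝ)] with i hi
  by_contra hc
  have := hn ⟨γ i, hc, rfl⟩
  exact absurd hi (not_lt.2 (by exact_mod_cast this))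

theorem gromovProduct_self (x : Γ) :
    gromovProduct S.carrier 1 x x = wordDist S.carrier 1 x := by
  simp [gromovProduct, wordDist_self]

theorem gromovProduct_le_left (w x y : Γ) :
    gromovProduct S.carrier w x y ≤ wordDist S.carrier w x := by
  have h := wordDist_triangle S w x y
  have h' : (wordDist S.carrier w y : ℝ) ≤ wordDist S.carrier w x + wordDist S.carrier x y := by
    exact_mod_cast h
  simp only [gromovProduct]
  linarith

theorem gromovProduct_le_right (w x y : Γ) :
    gromovProduct S.carrier w x y ≤ wordDist S.carrier w y := by
  rw [gromovProduct_comm]; exact gromovProduct_le_left S w y x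

theorem wordDist_one_inv (x : Γ) : wordDist S.carrier 1 x⁻¹ = wordDist S.carrier 1 x := by
  rw [← wordDist_mul_left S x, mul_one, mul_inv_cancel, wordDist_comm]

/-- The source of the dynamics: when `y` stays away from `γ⁻¹`, the point `γ * y` shares almost all
of the length of `γ`. -/
theorem gromovProduct_mul (γ y : Γ) : gromovProduct S.carrier 1 γ (γ * y) =
    wordDist S.carrier 1 γ - gromovProduct S.carrier 1 γ⁻¹ y := by
  have h1 : wordDist S.carrier γ (γ * y) = wordDist S.carrier 1 y := by
    simpa using wordDist_mul_left S γ 1 y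
  have h2 : wordDist S.carrier γ⁻¹ y = wordDist S.carrier 1 (γ * y) := by
    simpa using (wordDist_mul_left S γ γ⁻¹ y).symm
  simp only [gromovProduct, h1, h2, wordDist_one_inv]
  ring

theorem exists_hyperbolic_const : ∃ δ : ℝ, 0 ≤ δ ∧ ∀ w x y z : Γ,
    min (gromovProduct S.carrier w x y) (gromovProduct S.carrier w y z) - δ ≤
      gromovProduct S.carrier w x z := by
  obtain ⟨δ, hδ⟩ := S.hyperbolic
  refine ⟨max δ 0, le_max_right _ _, fun w x y z => (hδ w x y z).trans' ?_⟩
  linarith [le_max_left δ 0]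

/-- A nonnegative constant of hyperbolicity. -/
noncomputable def hyp : ℝ := (exists_hyperbolic_const S).choose

theorem hyp_nonneg : 0 ≤ hyp S := (exists_hyperbolic_const S).choose_spec.1

theorem le_gromovProduct {w x y z : Γ} {r : ℝ} (hxy : r ≤ gromovProduct S.carrier w x y)
    (hyz : r ≤ gromovProduct S.carrier w y z) : r - hyp S ≤ gromovProduct S.carrier w x z :=
  ((exists_hyperbolic_const S).choose_spec.2 w x y z).trans' (sub_le_sub_right (le_min hxy hyz) _)

/-! ### Proximity of points of `Γ ∪ ∂Γ` -/

theorem exists_represents (p : Γ ⊕ Boundary S) : ∃ x, Represents S x p := by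
  rcases p with g | ⟨⟨x, hx⟩⟩
  · exact ⟨fun _ => g, fun _ => rfl⟩
  · exact ⟨x, hx, rfl⟩

/-- `⟨p, q⟩ ≥ r`, in the sense that this holds far out along all representing sequences. -/
def Near (r : ℝ) (p q : Γ ⊕ Boundary S) : Prop :=
  ∀ x y, Represents S x p → Represents S y q →
    ∀ᶠ n : ℕ × ℕ in atTop, r ≤ gromovProduct S.carrier 1 (x n.1) (y n.2)

variable {S}

theorem tendsto_swap_atTop : Tendsto (Prod.swap : ℕ × ℕ → ℕ × ℕ) atTop atTop := by
  rw [← prod_atTop_atTop_eq]; exact tendsto_prod_swap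

theorem Near.symm {r : ℝ} {p q : Γ ⊕ Boundary S} (h : Near S r p q) : Near S r q p := by
  intro x y hx hy
  filter_upwards [tendsto_swap_atTop.eventually (h y x hy hx)] with n hn
  rw [gromovProduct_comm]; exact hn

theorem Near.mono {r r' : ℝ} {p q : Γ ⊕ Boundary S} (h : Near S r p q) (hr : r' ≤ r) :
    Near S r' p q :=
  fun x y hx hy => (h x y hx hy).mono fun _ hn => hr.trans hn

theorem near_self (r : ℝ) (ξ : Boundary S) : Near S r (Sum.inr ξ) (Sum.inr ξ) := by
  rintro x y ⟨hx, rfl⟩ ⟨hy, h⟩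
  exact tendsto_atTop.1 ((boundarySetoid S).symm (Quotient.exact h)) r

theorem eventually_atTop_prod {P : ℕ × ℕ → Prop} (h : ∀ᶠ n in atTop, P n) :
    ∃ N, ∀ i ≥ N, ∀ j ≥ N, P (i, j) := by
  obtain ⟨⟨a, b⟩, hab⟩ := eventually_atTop.1 h
  exact ⟨max a b, fun i hi j hj => hab (i, j)
    ⟨(le_max_left a b).trans hi, (le_max_right a b).trans hj⟩⟩

/-- Because `Near` quantifies over all representing sequences, one far term of a sequence for `q`
serves as the middle point, and a single `hyp S` is lost. -/
theorem Near.trans {r : ℝ} {p q s : Γ ⊕ Boundary S} (h : Near S r p q) (h' : Near S r q s) :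
    Near S (r - hyp S) p s := by
  intro x z hx hz
  obtain ⟨y, hy⟩ := exists_represents S q
  obtain ⟨N, hN⟩ := eventually_atTop_prod (h x y hx hy)
  obtain ⟨M, hM⟩ := eventually_atTop_prod (h' y z hy hz)
  filter_upwards [eventually_ge_atTop (max N M, max N M)] with n hn
  have h1 : max N M ≤ n.1 := hn.1
  have h2 : max N M ≤ n.2 := hn.2
  exact le_gromovProduct S (hN n.1 ((le_max_left _ _).trans h1) (max N M) (le_max_left _ _))
    (hM (max N M) (le_max_right _ _) n.2 ((le_max_right _ _).trans h2))

theorem near_inl_iff {r : ℝ} {g h : Γ} :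
    Near S r (Sum.inl g) (Sum.inl h) ↔ r ≤ gromovProduct S.carrier 1 g h := by
  refine ⟨fun H => ?_, fun H x y hx hy => Eventually.of_forall fun n => ?_⟩
  · obtain ⟨n, hn⟩ := (H (fun _ => g) (fun _ => h) (fun _ => rfl) fun _ => rfl).exists
    exact hn
  · rwa [hx, hy]

theorem Near.le_wordDist {r : ℝ} {g : Γ} {q : Γ ⊕ Boundary S} (h : Near S r (Sum.inl g) q) :
    r ≤ wordDist S.carrier 1 g := by
  obtain ⟨y, hy⟩ := exists_represents S q
  obtain ⟨n, hn⟩ := (h (fun _ => g) y (fun _ => rfl) hy).exists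
  exact hn.trans (gromovProduct_le_left S 1 _ _)

theorem eventually_represents {r : ℝ} {p : Γ ⊕ Boundary S} {x x' : ℕ → Γ} (hx : Represents S x p)
    (hx' : Represents S x' p) (h : ∃ᶠ n in atTop, r ≤ (wordDist S.carrier 1 (x n) : ℝ)) :
    ∀ᶠ n : ℕ × ℕ in atTop, r ≤ gromovProduct S.carrier 1 (x n.1) (x' n.2) := by
  rcases p with g | ξ
  · obtain ⟨n, hn⟩ := h.exists
    refine Eventually.of_forall fun m => ?_
    rw [hx, hx', gromovProduct_self, ← hx n]; exact hn
  · exact near_self r ξ x x' hx hx'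

/-- If `⟨x i, y j⟩ ≥ r` for some `i`, `j` arbitrarily far out along one pair of representing
sequences, then `⟨p, q⟩ ≥ r`, up to a constant. -/
theorem near_of_frequently {r : ℝ} {p q : Γ ⊕ Boundary S} {x y : ℕ → Γ} (hx : Represents S x p)
    (hy : Represents S y q)
    (h : ∃ᶠ n : ℕ × ℕ in atTop, r ≤ gromovProduct S.carrier 1 (x n.1) (y n.2)) :
    Near S (r - 2 * hyp S) p q := by
  intro x' y' hx' hy'
  have h1 : ∃ᶠ n in atTop, r ≤ (wordDist S.carrier 1 (x n) : ℝ) := by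
    refine Tendsto.frequently (f := Prod.fst) (l₁ := atTop) ?_
      (h.mono fun n hn => hn.trans (gromovProduct_le_left S _ _ _))
    rw [← prod_atTop_atTop_eq]; exact tendsto_fst
  have h2 : ∃ᶠ n in atTop, r ≤ (wordDist S.carrier 1 (y n) : ℝ) := by
    refine Tendsto.frequently (f := Prod.snd) (l₁ := atTop) ?_
      (h.mono fun n hn => hn.trans (gromovProduct_le_right S _ _ _))
    rw [← prod_atTop_atTop_eq]; exact tendsto_snd
  obtain ⟨N, hN⟩ := eventually_atTop_prod (eventually_represents hx hx' h1)
  obtain ⟨M, hM⟩ := eventually_atTop_prod (eventually_represents hy hy' h2)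
  obtain ⟨⟨i, j⟩, hij, hr⟩ := frequently_atTop.1 h (max N M, max N M)
  have hi : max N M ≤ i := hij.1
  have hj : max N M ≤ j := hij.2
  filter_upwards [eventually_ge_atTop (max N M, max N M)] with n hn
  have h1 : max N M ≤ n.1 := hn.1
  have h2 : max N M ≤ n.2 := hn.2
  -- Pass from `x'` to `x`, then to `y`, then to `y'`: two intermediate points, so `hyp S` is lost
  -- twice.
  have e1 := hN i ((le_max_left _ _).trans hi) n.1 ((le_max_left _ _).trans h1)
  have e2 := hM j ((le_max_right _ _).trans hj) n.2 ((le_max_right _ _).trans h2)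
  rw [gromovProduct_comm] at e1
  have e3 := le_gromovProduct S hr e2
  have e4 := le_gromovProduct S (r := r - hyp S) (by linarith [hyp_nonneg S]) e3
  linarith

/-- Together with `Near.lt_extProduct`, this makes `Near` and the sup-liminf product agree up to a
constant, hence define the same neighbourhoods. -/
theorem near_of_lt_extProduct {r : ℝ} {p q : Γ ⊕ Boundary S} (h : (r : EReal) < extProduct S p q) :
    Near S (r - 2 * hyp S) p q := by
  simp only [extProduct, lt_iSup_iff] at h
  obtain ⟨x, y, hx, hy, h⟩ := h
  refine near_of_frequently hx hy (Eventually.frequently ?_)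
  filter_upwards [eventually_lt_of_lt_liminf h] with n hn
  exact (EReal.coe_lt_coe_iff.1 hn).le

theorem Near.lt_extProduct {r r' : ℝ} {p q : Γ ⊕ Boundary S} (h : Near S r' p q) (hr : r < r') :
    (r : EReal) < extProduct S p q := by
  obtain ⟨x, hx⟩ := exists_represents S p
  obtain ⟨y, hy⟩ := exists_represents S q
  simp only [extProduct, lt_iSup_iff]
  refine ⟨x, y, hx, hy, (EReal.coe_lt_coe_iff.2 hr).trans_le (le_liminf_of_le ?_ ?_)⟩
  · isBoundedDefault
  · filter_upwards [h x y hx hy] with n hn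
    exact EReal.coe_le_coe_iff.2 hn

theorem eq_of_near {p q : Γ ⊕ Boundary S} (h : ∀ r, Near S r p q) : p = q := by
  have aux : ∀ (g : Γ) (q : Γ ⊕ Boundary S), ¬ ∀ r, Near S r (Sum.inl g) q := fun g q h => by
    have := (h (wordDist S.carrier 1 g + 1)).le_wordDist
    linarith
  rcases p with g | ξ
  · exact (aux _ _ h).elim
  rcases q with g | ζ
  · exact (aux _ _ fun r => (h r).symm).elim
  obtain ⟨x, hx, rfl⟩ := exists_represents S (Sum.inr ξ)
  obtain ⟨y, hy, rfl⟩ := exists_represents S (Sum.inr ζ)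
  refine congrArg Sum.inr (Quotient.sound ?_)
  exact tendsto_atTop.2 fun r => h r x y ⟨hx, rfl⟩ ⟨hy, rfl⟩

end Word

/-! ### The uniform structure of `Γ ∪ ∂Γ` -/

section Uniform

variable {Γ : Type*} [Group Γ] (S : HyperbolicGeneratingSet Γ)

/-- The basic entourages of `Γ ∪ ∂Γ`. -/
def entourage (r : ℝ) : Set ((Γ ⊕ Boundary S) × (Γ ⊕ Boundary S)) :=
  {p | p.1 = p.2 ∨ Near S r p.1 p.2}

theorem entourage_anti : Antitone (entourage S) := fun _ _ h _ hp => hp.imp_right fun H => H.mono h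

/-- The filter generated by the basic entourages. -/
noncomputable def entourageFilter : Filter ((Γ ⊕ Boundary S) × (Γ ⊕ Boundary S)) :=
  ⨅ r : ℝ, 𝓟 (entourage S r)

theorem hasBasis_entourageFilter :
    (entourageFilter S).HasBasis (fun _ : ℝ => True) (entourage S) :=
  hasBasis_iInf_principal (entourage_anti S).directed_ge

theorem entourage_comp (r : ℝ) :
    SetRel.comp (entourage S (r + hyp S)) (entourage S (r + hyp S)) ⊆ entourage S r := by
  have h0 := hyp_nonneg S
  rintro ⟨p, s⟩ ⟨q, hpq, hqs⟩
  rcases hpq with h | h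
  · obtain rfl : p = q := h
    exact entourage_anti S (by linarith) hqs
  rcases hqs with h' | h'
  · obtain rfl : q = s := h'
    exact entourage_anti S (by linarith) (Or.inr h)
  · exact Or.inr ((h.trans h').mono (by simp))

/-- The uniform structure of `Γ ∪ ∂Γ`, without its topology. -/
noncomputable def uniformCore : UniformSpace.Core (Γ ⊕ Boundary S) where
  uniformity := entourageFilter S
  refl := (hasBasis_entourageFilter S).ge_iff.2 fun r _ => by
    rintro ⟨p, q⟩ h
    exact Or.inl h
  symm := by
    refine ((hasBasis_entourageFilter S).tendsto_iff (hasBasis_entourageFilter S)).2 fun r _ =>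
      ⟨r, trivial, ?_⟩
    rintro ⟨p, q⟩ (h | h)
    exacts [Or.inl h.symm, Or.inr h.symm]
  comp := by
    refine (hasBasis_entourageFilter S).ge_iff.2 fun r _ => ?_
    exact mem_of_superset (mem_lift' ((hasBasis_entourageFilter S).mem_of_mem trivial))
      (entourage_comp S r)

theorem uniformCore_toTopologicalSpace :
    (uniformCore S).toTopologicalSpace = gromovTopology S := by
  refine TopologicalSpace.ext_iff.2 fun U => ?_
  have h1 : IsOpen[(uniformCore S).toTopologicalSpace] U ↔
      ∀ p ∈ U, ∃ r : ℝ, ∀ q, (p, q) ∈ entourage S r → q ∈ U := by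
    let _ := UniformSpace.ofCore (uniformCore S)
    refine isOpen_uniformity.trans (forall₂_congr fun p _ => ?_)
    refine ((hasBasis_entourageFilter S).mem_iff).trans ?_
    simp only [true_and]
    refine exists_congr fun r => ⟨fun h q hq => h hq rfl, fun h q hq hp => h q.2 ?_⟩
    rwa [← hp]
  rw [h1]
  change _ ↔ ∀ ξ : Boundary S, Sum.inr ξ ∈ U →
    ∃ r : ℝ, ∀ p, (r : EReal) < extProduct S (Sum.inr ξ) p → p ∈ U
  constructor
  · intro h ξ hξ
    obtain ⟨r, hr⟩ := h _ hξ
    refine ⟨r + 2 * hyp S, fun q hq => hr q (Or.inr ?_)⟩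
    simpa using near_of_lt_extProduct hq
  · rintro h (g | ξ) hp
    -- Nothing is near `g` at a scale above its length, so this entourage isolates `g`.
    · refine ⟨wordDist S.carrier 1 g + 1, fun q hq => ?_⟩
      rcases hq with hq | hq
      · rwa [← show Sum.inl g = q from hq]
      · have := Near.le_wordDist hq
        linarith
    · obtain ⟨r, hr⟩ := h ξ hp
      refine ⟨r + 1, fun q hq => ?_⟩
      rcases hq with hq | hq
      · rwa [← show Sum.inr ξ = q from hq]
      · exact hr q (hq.lt_extProduct (by linarith))

/-- The uniform structure of the Gromov compactification. -/
noncomputable instance instUniformSpace : UniformSpace (Γ ⊕ Boundary S) where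
  -- With this field given explicitly, the topology of `Boundary S` is induced from the uniform one
  -- by definition.
  toTopologicalSpace := gromovTopology S
  uniformity := entourageFilter S
  symm := (uniformCore S).symm
  comp := (uniformCore S).comp
  nhds_eq_comap_uniformity p := by
    rw [← uniformCore_toTopologicalSpace]
    exact @nhds_eq_comap_uniformity _ (UniformSpace.ofCore (uniformCore S)) p

variable {S}

theorem hasBasis_uniformity :
    (uniformity (Γ ⊕ Boundary S)).HasBasis (fun _ : ℝ => True) (entourage S) :=
  hasBasis_entourageFilter S

instance : (uniformity (Γ ⊕ Boundary S)).IsCountablyGenerated := by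
  refine HasCountableBasis.isCountablyGenerated (ι := ℕ) (p := fun _ => True)
    (s := fun n => entourage S n) ⟨⟨fun t => ?_⟩, Set.to_countable _⟩
  rw [hasBasis_uniformity.mem_iff]
  simp only [true_and]
  refine ⟨fun ⟨r, hr⟩ => ?_, fun ⟨n, hn⟩ => ⟨n, hn⟩⟩
  obtain ⟨n, hn⟩ := exists_nat_ge r
  exact ⟨n, (entourage_anti S hn).trans hr⟩

instance : T0Space (Γ ⊕ Boundary S) := by
  rw [t0Space_iff_uniformity]
  intro p q h
  by_contra hne
  refine hne (eq_of_near fun r => ?_)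
  exact (h _ (hasBasis_uniformity.mem_of_mem (i := r) trivial)).resolve_left hne

instance : TopologicalSpace.MetrizableSpace (Γ ⊕ Boundary S) := UniformSpace.metrizableSpace

theorem tendsto_inr_iff {ι : Type*} {l : Filter ι} {f : ι → Γ ⊕ Boundary S} {ξ : Boundary S} :
    Tendsto f l (𝓝 (Sum.inr ξ)) ↔ ∀ r, ∀ᶠ i in l, Near S r (Sum.inr ξ) (f i) := by
  rw [(nhds_basis_uniformity' hasBasis_uniformity).tendsto_right_iff]
  simp only [true_imp_iff]
  refine forall_congr' fun r => eventually_congr (Eventually.of_forall fun i => ?_)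
  refine ⟨fun h => ?_, Or.inr⟩
  rcases h with h | h
  · rw [← show Sum.inr ξ = f i from h]; exact near_self r ξ
  · exact h

theorem isOpen_inl_image (A : Set Γ) : IsOpen (Sum.inl '' A : Set (Γ ⊕ Boundary S)) := by
  rintro ξ ⟨a, -, h⟩
  cases h

theorem isOpen_singleton_inl (g : Γ) : IsOpen {(Sum.inl g : Γ ⊕ Boundary S)} := by
  simpa using isOpen_inl_image (S := S) {g}

theorem tendsto_inl_of_represents {x : ℕ → Γ} {ξ : Boundary S} (hx : Represents S x (Sum.inr ξ)) :
    Tendsto (fun n => (Sum.inl (x n) : Γ ⊕ Boundary S)) atTop (𝓝 (Sum.inr ξ)) := by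
  refine tendsto_inr_iff.2 fun r => ?_
  obtain ⟨N, hN⟩ := eventually_atTop_prod (near_self (r + 2 * hyp S) ξ x x hx hx)
  filter_upwards [eventually_ge_atTop N] with n hn
  refine (near_of_frequently (r := r + 2 * hyp S) (q := Sum.inl (x n)) (y := fun _ => x n) hx
    (fun _ => rfl) (Eventually.frequently ?_)).mono (by simp)
  filter_upwards [eventually_ge_atTop (N, N)] with m hm
  exact hN m.1 hm.1 n hn

theorem denseRange_inl : DenseRange (Sum.inl : Γ → Γ ⊕ Boundary S) := by
  rintro (g | ξ)
  · exact subset_closure ⟨g, rfl⟩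
  · obtain ⟨x, hx⟩ := exists_represents S (Sum.inr ξ)
    exact mem_closure_of_tendsto (tendsto_inl_of_represents hx)
      (Eventually.of_forall fun n => ⟨x n, rfl⟩)

theorem isEmbedding_inr : IsEmbedding (Sum.inr : Boundary S → Γ ⊕ Boundary S) :=
  ⟨⟨rfl⟩, Sum.inr_injective⟩

theorem isClosedEmbedding_inr : IsClosedEmbedding (Sum.inr : Boundary S → Γ ⊕ Boundary S) := by
  refine ⟨isEmbedding_inr, ?_⟩
  rw [← Set.compl_range_inl, isClosed_compl_iff, ← Set.image_univ]
  exact isOpen_inl_image _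

/-- The prefix of length `n` of a geodesic word for `g` has Gromov product exactly `n` with `g`, so
a finite ball is a net for `Γ`; density of `Γ` does the rest. -/
theorem totallyBounded_univ : TotallyBounded (Set.univ : Set (Γ ⊕ Boundary S)) := by
  rw [← (denseRange_inl (S := S)).closure_range]
  refine TotallyBounded.closure (hasBasis_uniformity.totallyBounded_iff.2 fun r _ => ?_)
  obtain ⟨n, hn⟩ := exists_nat_ge r
  refine ⟨Sum.inl '' {g | wordDist S.carrier 1 g ≤ n}, (finite_ball S n).image _, ?_⟩
  rintro _ ⟨g, rfl⟩
  simp only [Set.mem_iUnion, Set.mem_image, exists_prop, exists_exists_and_eq_and]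
  rcases le_total (wordDist S.carrier 1 g) n with h | h
  · exact ⟨g, h, Or.inl rfl⟩
  · obtain ⟨a, ha, hag⟩ := exists_prefix S g h
    refine ⟨a, ha.le, Or.inr (Near.symm (near_inl_iff.2 (hn.trans (le_of_eq ?_))))⟩
    simp only [gromovProduct, ← hag, ha]
    push_cast
    ring

/-- If the lengths tend to infinity, the Cauchy condition is convergence to infinity. Otherwise some
late term is shorter than a scale `R` for which the Cauchy condition already holds; only equality is
then possible, and the sequence is eventually constant. -/
theorem exists_tendsto_of_cauchySeq_inl {x : ℕ → Γ}
    (h : CauchySeq fun n => (Sum.inl (x n) : Γ ⊕ Boundary S)) :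
    ∃ p : Γ ⊕ Boundary S, Tendsto (fun n => (Sum.inl (x n) : Γ ⊕ Boundary S)) atTop (𝓝 p) := by
  have hc : ∀ r : ℝ, ∃ N, ∀ i ≥ N, ∀ j ≥ N,
      x i = x j ∨ r ≤ gromovProduct S.carrier 1 (x i) (x j) := fun r => by
    obtain ⟨N, hN⟩ := (hasBasis_uniformity.cauchySeq_iff.1 h) r trivial
    refine ⟨N, fun i hi j hj => ?_⟩
    exact (hN i hi j hj).imp (fun h => Sum.inl_injective h) near_inl_iff.1
  by_cases hinf : Tendsto (fun n => (wordDist S.carrier 1 (x n) : ℝ)) atTop atTop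
  · have hx : ConvergesToInfinity S x := by
      refine tendsto_atTop.2 fun r => ?_
      obtain ⟨N, hN⟩ := hc r
      obtain ⟨M, hM⟩ := eventually_atTop.1 (hinf.eventually_ge_atTop r)
      filter_upwards [eventually_ge_atTop (max N M, max N M)] with n hn
      have h1 : max N M ≤ n.1 := hn.1
      have h2 : max N M ≤ n.2 := hn.2
      rcases hN n.1 ((le_max_left _ _).trans h1) n.2 ((le_max_left _ _).trans h2) with h | h
      · rw [← h, gromovProduct_self]
        exact hM _ ((le_max_right _ _).trans h1)
      · exact h
    exact ⟨_, tendsto_inl_of_represents ⟨hx, rfl⟩⟩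
  · obtain ⟨R, hR⟩ := not_forall.1 (mt tendsto_atTop.2 hinf)
    obtain ⟨N, hN⟩ := hc R
    obtain ⟨i, hi, hiR⟩ := frequently_atTop.1 (not_eventually.1 hR) N
    refine ⟨Sum.inl (x i), tendsto_const_nhds.congr' ?_⟩
    filter_upwards [eventually_ge_atTop N] with j hj
    rcases hN i hi j hj with h | h
    · rw [h]
    · exact absurd (h.trans (gromovProduct_le_left S _ _ _)) hiR

instance : CompleteSpace (Γ ⊕ Boundary S) := by
  refine UniformSpace.complete_of_cauchySeq_tendsto fun p hp => ?_
  -- By density, replace the Cauchy sequence by an asymptotic one in `Γ`.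
  have happ : ∀ n : ℕ, ∃ g : Γ, (p n, Sum.inl g) ∈ entourage S n := fun n => by
    have hU : {q | (p n, q) ∈ entourage S n} ∈ 𝓝 (p n) :=
      UniformSpace.mem_nhds_iff.2 ⟨_, hasBasis_uniformity.mem_of_mem (i := (n : ℝ)) trivial,
        fun _ h => h⟩
    obtain ⟨_, hg, g, rfl⟩ := mem_closure_iff_nhds.1 (denseRange_inl (S := S) (p n)) _ hU
    exact ⟨g, hg⟩
  choose x hx using happ
  have hu : Tendsto (fun n => (p n, (Sum.inl (x n) : Γ ⊕ Boundary S))) atTop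
      (uniformity (Γ ⊕ Boundary S)) := by
    refine hasBasis_uniformity.tendsto_right_iff.2 fun r _ => ?_
    filter_upwards [tendsto_natCast_atTop_atTop.eventually_ge_atTop r] with n hn
    exact entourage_anti S hn (hx n)
  have hc : CauchySeq fun n => (Sum.inl (x n) : Γ ⊕ Boundary S) := by
    rw [cauchySeq_iff_tendsto, ← prod_atTop_atTop_eq] at hp ⊢
    exact ((hu.uniformity_symm.comp tendsto_fst).uniformity_trans hp).uniformity_trans
      (hu.comp tendsto_snd)
  obtain ⟨q, hq⟩ := exists_tendsto_of_cauchySeq_inl hc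
  exact ⟨q, hq.congr_uniformity hu.uniformity_symm⟩

instance : CompactSpace (Γ ⊕ Boundary S) :=
  ⟨isCompact_iff_totallyBounded_isComplete.2 ⟨totallyBounded_univ,
    completeSpace_iff_isComplete_univ.1 inferInstance⟩⟩

instance : CompactSpace (Boundary S) := isClosedEmbedding_inr.compactSpace

instance : TopologicalSpace.MetrizableSpace (Boundary S) := isEmbedding_inr.metrizableSpace

end Uniform

/-! ### Dynamics on the boundary -/

section Dynamics

variable {Γ : Type*} [Group Γ] {S : HyperbolicGeneratingSet Γ}

theorem tendsto_inr_iff_boundary {ι : Type*} {l : Filter ι} {f : ι → Boundary S} {ξ : Boundary S} :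
    Tendsto (fun i => (Sum.inr (f i) : Γ ⊕ Boundary S)) l (𝓝 (Sum.inr ξ)) ↔ Tendsto f l (𝓝 ξ) :=
  (isEmbedding_inr (S := S)).tendsto_nhds_iff.symm

/-- Convergence dynamics: if `γ → ζ` and `γ⁻¹ → η`, then `γ z → ζ` for every `z ≠ η`. -/
theorem tendsto_smul_of_ne {ι : Type*} {l : Filter ι} {γ : ι → Γ} {ζ η z : Boundary S}
    (hγ : Tendsto (fun i => (Sum.inl (γ i) : Γ ⊕ Boundary S)) l (𝓝 (Sum.inr ζ)))
    (hγ' : Tendsto (fun i => (Sum.inl (γ i)⁻¹ : Γ ⊕ Boundary S)) l (𝓝 (Sum.inr η)))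
    (hz : z ≠ η) : Tendsto (fun i => γ i • z) l (𝓝 ζ) := by
  rw [← tendsto_inr_iff_boundary]
  rw [tendsto_inr_iff] at hγ hγ' ⊢
  intro r
  obtain ⟨R, hR⟩ : ∃ R, ¬ Near S R (Sum.inr η) (Sum.inr z) := by
    by_contra! h
    exact hz (Sum.inr_injective (eq_of_near h)).symm
  -- The second condition serves only to make `γ i` long: subtracting the bound `R + 3 * hyp S` on
  -- `⟨γ⁻¹, y⟩` leaves `r + 3 * hyp S`.
  filter_upwards [hγ (r + hyp S), hγ (r + R + 6 * hyp S), hγ' (R + hyp S)] with i h1 h2 h3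
  have hlen := h2.symm.le_wordDist
  obtain ⟨y, hy⟩ := exists_represents S (Sum.inr z)
  have h4 : ¬ Near S (R + hyp S) (Sum.inl (γ i)⁻¹) (Sum.inr z) := fun h =>
    hR ((h3.trans h).mono (by simp))
  have h5 : ∀ᶠ n : ℕ × ℕ in atTop,
      gromovProduct S.carrier 1 (γ i)⁻¹ (y n.2) < R + 3 * hyp S := by
    by_contra hc
    refine h4 ((near_of_frequently (r := R + 3 * hyp S) (p := Sum.inl (γ i)⁻¹)
      (x := fun _ => (γ i)⁻¹) (fun _ => rfl) hy ?_).mono (by linarith))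
    exact (not_eventually.1 hc).mono fun n hn => not_lt.1 hn
  have h6 : Near S (r + hyp S) (Sum.inl (γ i)) (Sum.inr (γ i • z)) := by
    refine (near_of_frequently (r := r + 3 * hyp S) (p := Sum.inl (γ i))
      (x := fun _ => γ i) (fun _ => rfl) (hy.mul (γ i)) (Eventually.frequently ?_)).mono
      (by linarith)
    filter_upwards [h5] with n hn
    rw [gromovProduct_mul]
    linarith
  exact (h1.trans h6).mono (by simp)

/-- Points on an approximate geodesic ray from `1` to `ξ`. -/
theorem exists_ray (ξ : Boundary S) (n : ℕ) : ∃ g : Γ, wordDist S.carrier 1 g = n ∧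
    Near S (n - 3 * hyp S) (Sum.inl g) (Sum.inr ξ) := by
  obtain ⟨y, hy⟩ := exists_represents S (Sum.inr ξ)
  obtain ⟨N, hN⟩ := eventually_atTop_prod (near_self (n : ℝ) ξ y y hy hy)
  have h1 : n ≤ wordDist S.carrier 1 (y N) := by
    have := (hN N le_rfl N le_rfl).trans (gromovProduct_le_left S _ _ _)
    exact_mod_cast this
  obtain ⟨g, hg, hgy⟩ := exists_prefix S (y N) h1
  refine ⟨g, hg, ?_⟩
  have h2 : (n : ℝ) ≤ gromovProduct S.carrier 1 g (y N) := by
    refine le_of_eq ?_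
    simp only [gromovProduct, ← hgy, hg]
    push_cast
    ring
  -- One `hyp S` is lost in passing from `y N` to later terms, and two in `near_of_frequently`.
  refine (near_of_frequently (r := n - hyp S) (p := Sum.inl g) (x := fun _ => g) (fun _ => rfl)
    hy (Eventually.frequently ?_)).mono (by linarith)
  filter_upwards [eventually_ge_atTop (N, N)] with m hm
  exact le_gromovProduct S h2 (hN N le_rfl m.2 hm.2)

theorem tendsto_cofinite_of_tendsto {ι : Type*} {l : Filter ι} {γ : ι → Γ} {ξ : Boundary S}
    (h : Tendsto (fun i => (Sum.inl (γ i) : Γ ⊕ Boundary S)) l (𝓝 (Sum.inr ξ))) :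
    Tendsto γ l cofinite :=
  (tendsto_cofinite_iff S).2 (tendsto_atTop.2 fun r =>
    (tendsto_inr_iff.1 h r).mono fun _ hi => hi.symm.le_wordDist)

theorem exists_inr_of_tendsto {ι : Type*} {l : Filter ι} [l.NeBot] {γ : ι → Γ}
    (hγ : Tendsto γ l cofinite) {p : Γ ⊕ Boundary S}
    (h : Tendsto (fun i => (Sum.inl (γ i) : Γ ⊕ Boundary S)) l (𝓝 p)) :
    ∃ ξ, p = Sum.inr ξ := by
  rcases p with g | ξ
  · have h1 : ∀ᶠ i in l, γ i = g := by
      filter_upwards [h ((isOpen_singleton_inl (S := S) g).mem_nhds rfl)] with i hi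
      exact Sum.inl_injective hi
    obtain ⟨i, hi, hi'⟩ := (h1.and (hγ (Set.finite_singleton g).compl_mem_cofinite)).exists
    exact (hi' hi).elim
  · exact ⟨ξ, rfl⟩

theorem exists_subseq_tendsto {γ : ℕ → Γ} (hγ : Tendsto γ atTop cofinite) :
    ∃ (ξ : Boundary S) (φ : ℕ → ℕ), StrictMono φ ∧
      Tendsto (fun n => (Sum.inl (γ (φ n)) : Γ ⊕ Boundary S)) atTop (𝓝 (Sum.inr ξ)) := by
  obtain ⟨p, φ, hφ, h⟩ := CompactSpace.tendsto_subseq fun n => (Sum.inl (γ n) : Γ ⊕ Boundary S)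
  obtain ⟨ξ, rfl⟩ := exists_inr_of_tendsto (hγ.comp hφ.tendsto_atTop) h
  exact ⟨ξ, φ, hφ, h⟩

theorem tendsto_inv_cofinite {ι : Type*} {l : Filter ι} {γ : ι → Γ} (hγ : Tendsto γ l cofinite) :
    Tendsto (fun i => (γ i)⁻¹) l cofinite :=
  inv_injective.tendsto_cofinite.comp hγ

/-- Every boundary point `x₀` is conical: there is a sequence `γ` converging to a boundary point
such that `γ x₀` converges to another one. -/
theorem exists_tendsto_smul_ne (x₀ : Boundary S) : ∃ (γ : ℕ → Γ) (ξ ζ : Boundary S), ζ ≠ ξ ∧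
    Tendsto (fun n => (Sum.inl (γ n) : Γ ⊕ Boundary S)) atTop (𝓝 (Sum.inr ξ)) ∧
    Tendsto (fun n => γ n • x₀) atTop (𝓝 ζ) := by
  choose g hg hgx using exists_ray x₀
  have hcof : Tendsto (fun n => (g n)⁻¹) atTop cofinite := by
    refine (tendsto_cofinite_iff S).2 (tendsto_natCast_atTop_atTop.congr fun n => ?_)
    rw [wordDist_one_inv, hg]
  obtain ⟨ξ, φ, hφ, hξ⟩ := exists_subseq_tendsto (S := S) hcof
  obtain ⟨ζ, ψ, hψ, hζ⟩ := CompactSpace.tendsto_subseq fun n => (g (φ n))⁻¹ • x₀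
  refine ⟨fun n => (g (φ (ψ n)))⁻¹, ξ, ζ, ?_, hξ.comp hψ.tendsto_atTop, hζ⟩
  rintro rfl
  -- Equal limits would give `⟨a⁻¹, a⁻¹ x₀⟩ ≥ 4 * hyp S + 1`. But this product is `|a| - ⟨a, x₀⟩`,
  -- at most `3 * hyp S` since `a` lies on the ray.
  have h1 := tendsto_inr_iff.1 (hξ.comp hψ.tendsto_atTop) (5 * hyp S + 1)
  have h2 := tendsto_inr_iff.1 (tendsto_inr_iff_boundary.2 hζ) (5 * hyp S + 1)
  obtain ⟨n, hn1, hn2⟩ := (h1.and h2).exists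
  set a := g (φ (ψ n)) with ha
  obtain ⟨y, hy⟩ := exists_represents S (Sum.inr x₀)
  have h3 := (hn1.symm.trans hn2) (fun _ => a⁻¹) _ (fun _ => rfl) (hy.mul a⁻¹)
  obtain ⟨k, hk1, hk2⟩ := (h3.and (hgx (φ (ψ n)) (fun _ => a) y (fun _ => rfl) hy)).exists
  rw [gromovProduct_mul, inv_inv, wordDist_one_inv, ha, hg] at hk1
  rw [← ha] at hk1
  linarith [hyp_nonneg S]

/-! ### Stabilizers of boundary points -/

/-- Both products with `g` are at most `|g| ≤ ⟨a, b⟩`, so in each four-point inequality the minimum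
is the product with `g`. -/
theorem abs_gromovProduct_sub_le {g a b : Γ}
    (h : (wordDist S.carrier 1 g : ℝ) ≤ gromovProduct S.carrier 1 a b) :
    |gromovProduct S.carrier 1 g a - gromovProduct S.carrier 1 g b| ≤ hyp S := by
  have h1 := le_gromovProduct S le_rfl ((gromovProduct_le_left S 1 g a).trans h)
  rw [gromovProduct_comm] at h
  have h2 := le_gromovProduct S le_rfl ((gromovProduct_le_left S 1 g b).trans h)
  rw [abs_le]
  constructor <;> linarith

/-- `β` is a Busemann function at `ξ`, up to a bounded error. -/
def IsBusemann (ξ : Boundary S) (β : Γ → ℝ) : Prop :=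
  ∀ g y, Represents S y (Sum.inr ξ) →
    ∀ᶠ k in atTop, |(wordDist S.carrier g (y k) : ℝ) - wordDist S.carrier 1 (y k) - β g|
      ≤ 4 * hyp S

theorem exists_isBusemann (ξ : Boundary S) : ∃ β : Γ → ℝ, IsBusemann ξ β := by
  obtain ⟨z, hz⟩ := exists_represents S (Sum.inr ξ)
  have hN : ∀ g : Γ, ∃ N, ∀ i ≥ N, ∀ j ≥ N,
      (wordDist S.carrier 1 g : ℝ) ≤ gromovProduct S.carrier 1 (z i) (z j) := fun g =>
    eventually_atTop_prod (near_self _ ξ z z hz hz)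
  choose N hN using hN
  have hd : ∀ g a : Γ, (wordDist S.carrier g a : ℝ) - wordDist S.carrier 1 a =
      wordDist S.carrier 1 g - 2 * gromovProduct S.carrier 1 g a := fun g a => by
    simp only [gromovProduct]; ring
  -- The index `N g` is where the tail of `z` looks constant from `g`. Two comparisons of Gromov
  -- products, doubled by `hd`, give the error `4 * hyp S`.
  refine ⟨fun g => wordDist S.carrier g (z (N g)) - wordDist S.carrier 1 (z (N g)),
    fun g y hy => ?_⟩
  obtain ⟨M, hM⟩ := eventually_atTop_prod
    (near_self (wordDist S.carrier 1 g : ℝ) ξ y z hy hz)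
  filter_upwards [eventually_ge_atTop M] with k hk
  have h1 := abs_le.1 (abs_gromovProduct_sub_le (hM k hk (max M (N g)) (le_max_left _ _)))
  have h2 := abs_le.1 (abs_gromovProduct_sub_le (hN g _ (le_max_right M (N g)) (N g) le_rfl))
  simp only [hd]
  rw [abs_le]
  constructor <;> linarith [h1.1, h1.2, h2.1, h2.2]

theorem represents_inv_mul {ξ : Boundary S} {g : Γ} (hg : g • ξ = ξ) {y : ℕ → Γ}
    (hy : Represents S y (Sum.inr ξ)) : Represents S (fun k => g⁻¹ * y k) (Sum.inr ξ) := by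
  have h := hy.mul g⁻¹
  rwa [show g⁻¹ • (Sum.inr ξ : Γ ⊕ Boundary S) = Sum.inr ξ from
    congrArg Sum.inr (inv_smul_eq_iff.2 hg.symm)] at h

theorem wordDist_inv_mul (g h x : Γ) :
    wordDist S.carrier h (g⁻¹ * x) = wordDist S.carrier (g * h) x := by
  simpa using (wordDist_mul_left S g h (g⁻¹ * x)).symm

/-- As `g` fixes `ξ`, `β h` may be computed along `g⁻¹ * y`, which gives `d(g * h, y) - d(g, y)`.
The sum telescopes, with three errors of `4 * hyp S`. -/
theorem IsBusemann.abs_mul_sub_le {ξ : Boundary S} {β : Γ → ℝ} (hβ : IsBusemann ξ β) {g : Γ}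
    (hg : g • ξ = ξ) (h : Γ) : |β (g * h) - β g - β h| ≤ 12 * hyp S := by
  obtain ⟨y, hy⟩ := exists_represents S (Sum.inr ξ)
  obtain ⟨k, ⟨h1, h2⟩, h3⟩ := (((hβ (g * h) y hy).and (hβ g y hy)).and
    (hβ h _ (represents_inv_mul hg hy))).exists
  rw [wordDist_inv_mul, wordDist_inv_mul, mul_one] at h3
  rw [abs_le] at *
  constructor <;> linarith [h1.1, h1.2, h2.1, h2.2, h3.1, h3.2]

theorem IsBusemann.abs_one_le {ξ : Boundary S} {β : Γ → ℝ} (hβ : IsBusemann ξ β) :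
    |β 1| ≤ 4 * hyp S := by
  obtain ⟨y, hy⟩ := exists_represents S (Sum.inr ξ)
  obtain ⟨k, h1⟩ := (hβ 1 y hy).exists
  simpa using h1

/-- Elements fixing `ξ` and almost preserving the horospheres at `ξ` move points far along a ray to
`ξ` by a bounded amount. -/
theorem IsBusemann.wordDist_le {ξ : Boundary S} {β : Γ → ℝ} (hβ : IsBusemann ξ β) {g t : Γ}
    (hg : g • ξ = ξ) {C : ℝ} (hC : |β g| ≤ C) {n : ℕ} (hn : wordDist S.carrier 1 g ≤ n)
    (ht : wordDist S.carrier 1 t = n) (hnear : Near S (n - 3 * hyp S) (Sum.inl t) (Sum.inr ξ)) :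
    (wordDist S.carrier t (g * t) : ℝ) ≤ 40 * hyp S + 3 * C := by
  have h0 := hyp_nonneg S
  have hC0 : 0 ≤ C := (abs_nonneg _).trans hC
  obtain ⟨y, hy⟩ := exists_represents S (Sum.inr ξ)
  have hswap : Tendsto (Prod.snd : ℕ × ℕ → ℕ) atTop atTop := by
    rw [← prod_atTop_atTop_eq]; exact tendsto_snd
  obtain ⟨k, ⟨ha, hb⟩, hc⟩ := (((hnear (fun _ => t) y (fun _ => rfl) hy).and
    (hnear (fun _ => t) _ (fun _ => rfl) (represents_inv_mul hg hy))).and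
    (hswap.eventually (hβ g y hy))).exists
  generalize y k.2 = z at ha hb hc
  have hn' : (wordDist S.carrier 1 g : ℝ) ≤ n := by exact_mod_cast hn
  have htri : (wordDist S.carrier g z : ℝ) ≤ n + wordDist S.carrier (g * t) z := by
    have h1 := wordDist_triangle S g (g * t) z
    have h2 := wordDist_mul_left S g 1 t
    rw [mul_one, ht] at h2
    rw [h2] at h1
    exact_mod_cast h1
  have htri' : (wordDist S.carrier 1 z : ℝ) ≤ n + wordDist S.carrier t z := by
    have h1 := wordDist_triangle S 1 t z
    rw [ht] at h1
    exact_mod_cast h1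
  have hgt : wordDist S.carrier g (g * t) = n := by
    rw [← ht, ← wordDist_mul_left S g 1 t, mul_one]
  rw [abs_le] at hc hC
  simp only [gromovProduct, wordDist_inv_mul, ht, mul_one] at ha hb
  -- Seen from `z`, far out towards `ξ`, consecutive points of the chain `t`, `1`, `g`, `g * t` have
  -- Gromov product at least about `d(t, z)`. Hence so do `t` and `g * t`, which are about equally
  -- far from `z`.
  have e1 : wordDist S.carrier t z - 13 * hyp S - C ≤ gromovProduct S.carrier z t 1 := by
    simp only [gromovProduct, wordDist_comm S z, wordDist_comm S t 1, ht]
    linarith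
  have e2 : wordDist S.carrier t z - 13 * hyp S - C ≤ gromovProduct S.carrier z 1 g := by
    simp only [gromovProduct, wordDist_comm S z]
    linarith [hc.1, hc.2, hC.1, hC.2]
  have e3 : wordDist S.carrier t z - 13 * hyp S - C ≤ gromovProduct S.carrier z g (g * t) := by
    simp only [gromovProduct, wordDist_comm S z, hgt]
    linarith [hc.1, hc.2, hC.1, hC.2]
  have e4 := le_gromovProduct S e1 e2
  have e5 := le_gromovProduct S (r := wordDist S.carrier t z - 13 * hyp S - C - hyp S) e4
    (by linarith)
  simp only [gromovProduct, wordDist_comm S z] at e5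
  linarith [hc.1, hc.2, hC.1, hC.2]

/-- For `t` far enough along a ray, `g ↦ t⁻¹ * g * t` injects any finite part of this set into a
ball whose radius does not depend on that part. -/
theorem IsBusemann.finite_setOf_abs_le {ξ : Boundary S} {β : Γ → ℝ} (hβ : IsBusemann ξ β)
    (C : ℝ) : {g : Γ | g • ξ = ξ ∧ |β g| ≤ C}.Finite := by
  by_contra hinf
  obtain ⟨m, hm⟩ := exists_nat_ge (40 * hyp S + 3 * C)
  have hB := finite_ball S m
  obtain ⟨F, hF, hcard⟩ := Set.Infinite.exists_subset_card_eq hinf (hB.toFinset.card + 1)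
  obtain ⟨n, hn⟩ := (F.image (wordDist S.carrier 1)).bddAbove
  obtain ⟨t, ht, hnear⟩ := exists_ray ξ n
  classical
  have hle : F.card ≤ hB.toFinset.card := by
    refine Finset.card_le_card_of_injOn (fun g => t⁻¹ * (g * t)) (fun g hg => ?_)
      (fun a _ b _ h => ?_)
    · have h1 := hβ.wordDist_le (hF hg).1 (hF hg).2
        (hn (Finset.mem_coe.2 (Finset.mem_image_of_mem _ hg))) ht hnear
      have h2 : wordDist S.carrier 1 (t⁻¹ * (g * t)) = wordDist S.carrier t (g * t) := by
        rw [wordDist_inv_mul, mul_one]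
      rw [Finset.mem_coe, Set.Finite.mem_toFinset, Set.mem_ofPred_eq, h2]
      exact_mod_cast h1.trans hm
    · simpa using h
  omega

/-- If `o` represents `g H` and `k * (g⁻¹ * o) = f ∈ F`, then `g K = o * f⁻¹ K`; so `Γ ⧸ H` and `F`
together exhaust `Γ ⧸ K`. -/
theorem finiteIndex_of_finite {K H : Subgroup Γ} [H.FiniteIndex] {F : Set Γ} (hF : F.Finite)
    (h : ∀ x ∈ H, ∃ k ∈ K, k * x ∈ F) : K.FiniteIndex := by
  have hsurj : Function.Surjective (fun p : (Γ ⧸ H) × F =>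
      (QuotientGroup.mk (p.1.out * (p.2 : Γ)⁻¹) : Γ ⧸ K)) := by
    intro q
    induction q using QuotientGroup.induction_on with
    | H g =>
      have hx : (g⁻¹ * (QuotientGroup.mk g : Γ ⧸ H).out) ∈ H :=
        QuotientGroup.eq.1 (QuotientGroup.out_eq' _).symm
      obtain ⟨k, hk, hkF⟩ := h _ hx
      refine ⟨⟨QuotientGroup.mk g, ⟨_, hkF⟩⟩, ?_⟩
      refine QuotientGroup.eq.2 ?_
      simpa [mul_assoc] using hk
  have : Finite F := hF
  have : Finite (Γ ⧸ H) := inferInstance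
  have : Finite (Γ ⧸ K) := Finite.of_surjective _ hsurj
  exact Subgroup.finiteIndex_of_finite_quotient

/-- A hyperbolic group with a finite orbit on its boundary is virtually cyclic. -/
theorem isElementary_of_finiteIndex_stabilizer (ξ : Boundary S)
    [(MulAction.stabilizer Γ ξ).FiniteIndex] : IsElementary Γ := by
  obtain ⟨β, hβ⟩ := exists_isBusemann ξ
  have h0 := hyp_nonneg S
  -- A large `β t` allows division with remainder by `t` in the stabilizer. The error of `β (t⁻¹ *
  -- x)` against `β x - β t` is `12 + 12 + 4 = 28` times `hyp S`; the extra `1` makes the integer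
  -- part of `|β x|` drop.
  by_cases ht : ∃ t : Γ, t • ξ = ξ ∧ 28 * hyp S + 1 < |β t|
  · obtain ⟨t, ht, hL⟩ := ht
    refine ⟨Subgroup.zpowers t, ?_, inferInstance⟩
    have ht' : t⁻¹ • ξ = ξ := inv_smul_eq_iff.2 ht.symm
    have hinv := hβ.abs_mul_sub_le ht t⁻¹
    rw [mul_inv_cancel] at hinv
    have hone := hβ.abs_one_le
    refine finiteIndex_of_finite (H := MulAction.stabilizer Γ ξ)
      (hβ.finite_setOf_abs_le |β t|) ?_
    suffices ∀ n : ℕ, ∀ x : Γ, x • ξ = ξ → ⌊|β x|⌋₊ = n →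
        ∃ k ∈ Subgroup.zpowers t, k * x ∈ {g : Γ | g • ξ = ξ ∧ |β g| ≤ |β t|} from
      fun x hx => this _ x hx rfl
    intro n
    induction n using Nat.strong_induction_on with
    | _ n ih =>
      intro x hx hxn
      rcases le_or_gt |β x| |β t| with hle | hgt
      · exact ⟨1, one_mem _, by rw [one_mul]; exact ⟨hx, hle⟩⟩
      · have key : ∃ s ∈ Subgroup.zpowers t, s • ξ = ξ ∧ |β (s * x)| ≤ |β x| - 1 := by
          have h1 := abs_le.1 (hβ.abs_mul_sub_le ht x)
          have h2 := abs_le.1 (hβ.abs_mul_sub_le ht' x)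
          have h3 := abs_le.1 hinv
          have h4 := abs_le.1 hone
          -- Multiply by `t⁻¹` if `β t` and `β x` have the same sign, by `t` otherwise.
          rcases le_or_gt 0 (β t * β x) with hpos | hneg
          · refine ⟨t⁻¹, inv_mem (Subgroup.mem_zpowers t), ht', ?_⟩
            rcases le_total 0 (β t) with ha | ha <;> rcases le_total 0 (β x) with hb | hb
            · rw [abs_of_nonneg ha] at hL hgt; rw [abs_of_nonneg hb] at hgt ⊢
              rw [abs_le]; constructor <;> linarith [h1.1, h1.2, h2.1, h2.2, h3.1, h3.2, h4.1, h4.2]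
            · rw [abs_of_nonneg ha] at hL hgt; rw [abs_of_nonpos hb] at hgt
              nlinarith
            · rw [abs_of_nonpos ha] at hL hgt; rw [abs_of_nonneg hb] at hgt
              nlinarith
            · rw [abs_of_nonpos ha] at hL hgt; rw [abs_of_nonpos hb] at hgt ⊢
              rw [abs_le]; constructor <;> linarith [h1.1, h1.2, h2.1, h2.2, h3.1, h3.2, h4.1, h4.2]
          · refine ⟨t, Subgroup.mem_zpowers t, ht, ?_⟩
            rcases mul_neg_iff.1 hneg with ⟨ha, hb⟩ | ⟨ha, hb⟩
            · rw [abs_of_pos ha] at hL hgt; rw [abs_of_neg hb] at hgt ⊢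
              rw [abs_le]; constructor <;> linarith [h1.1, h1.2]
            · rw [abs_of_neg ha] at hL hgt; rw [abs_of_pos hb] at hgt ⊢
              rw [abs_le]; constructor <;> linarith [h1.1, h1.2]
        obtain ⟨s, hs, hsξ, hsx⟩ := key
        have hlt : ⌊|β (s * x)|⌋₊ < n := by
          rw [← hxn, Nat.floor_lt (abs_nonneg _)]
          have := Nat.lt_floor_add_one |β x|
          linarith
        obtain ⟨k, hk, hkx⟩ := ih _ hlt (s * x) (by rw [mul_smul, hx, hsξ]) rfl
        exact ⟨k * s, mul_mem hk hs, by rwa [mul_assoc]⟩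
  -- Here `β` is bounded on the stabilizer, which is therefore finite, and so is `Γ`.
  · push Not at ht
    refine ⟨⊥, ?_, inferInstance⟩
    refine finiteIndex_of_finite (H := MulAction.stabilizer Γ ξ)
      (hβ.finite_setOf_abs_le (28 * hyp S + 1)) fun x hx => ⟨1, one_mem _, ?_⟩
    rw [one_mul]
    exact ⟨hx, ht x hx⟩

end Dynamics

section Minimality

variable {Γ : Type*} [Group Γ] {S : HyperbolicGeneratingSet Γ}

/-! ### Minimality and non-atomic measures -/

/-- Elements `x n → ζ` of `Γ` push every point except one `η` to `ζ`. As `ξ` is not fixed by `Γ`,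
some point of its orbit differs from `η`. -/
theorem isMinimal_boundary (hΓ : ¬ IsElementary Γ) : MulAction.IsMinimal Γ (Boundary S) := by
  refine ⟨fun ξ ζ => ?_⟩
  obtain ⟨g, hg⟩ : ∃ g : Γ, g • ξ ≠ ξ := by
    by_contra! h
    have htop : MulAction.stabilizer Γ ξ = ⊤ := (Subgroup.eq_top_iff' _).2 h
    have : (MulAction.stabilizer Γ ξ).FiniteIndex := by rw [htop]; infer_instance
    exact hΓ (isElementary_of_finiteIndex_stabilizer ξ)
  obtain ⟨x, hx⟩ := exists_represents S (Sum.inr ζ)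
  have hxζ := tendsto_inl_of_represents hx
  obtain ⟨η, φ, hφ, hη⟩ := exists_subseq_tendsto (S := S)
    (tendsto_inv_cofinite (tendsto_cofinite_of_tendsto hxζ))
  obtain ⟨h, hh⟩ : ∃ h : Γ, h • ξ ≠ η := by
    by_cases h1 : ξ = η
    · exact ⟨g, h1 ▸ hg⟩
    · exact ⟨1, by rwa [one_smul]⟩
  refine mem_closure_of_tendsto
    (tendsto_smul_of_ne (hxζ.comp hφ.tendsto_atTop) hη hh) (Eventually.of_forall fun n => ?_)
  exact ⟨x (φ n) * h, mul_smul _ _ _⟩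

theorem nonempty_boundary [Infinite Γ] : Nonempty (Boundary S) := by
  have h : Tendsto (Infinite.natEmbedding Γ) atTop cofinite := by
    rw [← Nat.cofinite_eq_atTop]
    exact (Infinite.natEmbedding Γ).injective.tendsto_cofinite
  obtain ⟨ξ, -⟩ := exists_subseq_tendsto (S := S) h
  exact ⟨ξ⟩

theorem infinite_of_not_isElementary (hΓ : ¬ IsElementary Γ) : Infinite Γ := by
  by_contra h
  have : Finite Γ := not_infinite_iff_finite.1 h
  exact hΓ ⟨⊥, inferInstance, inferInstance⟩

/-- By minimality every orbit meets an isolated point, so the boundary would be one discrete orbit,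
finite by compactness. -/
theorem not_isOpen_singleton (hΓ : ¬ IsElementary Γ) (ξ : Boundary S) : ¬ IsOpen {ξ} := by
  intro hξ
  have horb : ∀ ζ : Boundary S, ∃ g : Γ, g • ξ = ζ := fun ζ => by
    obtain ⟨_, h, g, rfl⟩ :=
      ((isMinimal_boundary hΓ).dense_orbit ζ).inter_open_nonempty _ hξ ⟨ξ, rfl⟩
    exact ⟨g⁻¹, inv_smul_eq_iff.2 (Set.mem_singleton_iff.1 h).symm⟩
  have hdisc : DiscreteTopology (Boundary S) := by
    refine discreteTopology_iff_isOpen_singleton.2 fun ζ => ?_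
    obtain ⟨g, rfl⟩ := horb ζ
    simpa using hξ.smul g
  have hfin : Finite (Boundary S) := finite_of_compact_of_discrete
  have : (MulAction.stabilizer Γ ξ).FiniteIndex := by
    refine ⟨?_⟩
    rw [MulAction.index_stabilizer]
    exact ((Set.ncard_pos (Set.toFinite _)).2 (MulAction.nonempty_orbit ξ)).ne'
  exact hΓ (isElementary_of_finiteIndex_stabilizer ξ)

theorem not_countable_boundary (hΓ : ¬ IsElementary Γ) : ¬ Countable (Boundary S) := by
  have := infinite_of_not_isElementary hΓ
  obtain ⟨ξ⟩ := nonempty_boundary (S := S)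
  let _ : MetricSpace (Boundary S) := TopologicalSpace.metrizableSpaceMetric _
  have hperf : Perfect (Set.univ : Set (Boundary S)) := by
    refine ⟨isClosed_univ, fun ζ _ => ?_⟩
    rw [accPt_principal_iff_nhdsWithin, ← Set.compl_eq_univ_sdiff]
    exact ⟨fun h => not_isOpen_singleton hΓ ζ ((isOpen_singleton_iff_punctured_nhds ζ).2 h)⟩
  obtain ⟨f, -, -, hf⟩ := hperf.exists_nat_bool_injection ⟨ξ, trivial⟩
  intro h
  have := Cardinal.mk_le_aleph0_iff.2 hf.countable
  refine this.not_gt ?_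
  simpa using Cardinal.cantor Cardinal.aleph0

/-- Lebesgue measure on the unit interval is transported by a Borel isomorphism of uncountable
Polish spaces. -/
theorem exists_nonatomic (hΓ : ¬ IsElementary Γ) :
    ∃ ν : ProbabilityMeasure (Boundary S), ∀ ξ, (ν : Measure (Boundary S)) {ξ} = 0 := by
  have : PolishSpace (Boundary S) := by
    let _ : MetricSpace (Boundary S) := TopologicalSpace.metrizableSpaceMetric _
    infer_instance
  let e : unitInterval ≃ᵐ Boundary S := PolishSpace.measurableEquivOfNotCountable
    (fun h => (Cardinal.mk_le_aleph0_iff.2 h).not_gt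
      (Cardinal.mk_Icc_real zero_lt_one ▸ Cardinal.aleph0_lt_continuum)) (not_countable_boundary hΓ)
  refine ⟨⟨Measure.map e volume, Measure.isProbabilityMeasure_map e.measurable.aemeasurable⟩,
    fun ξ => ?_⟩
  change Measure.map e volume {ξ} = 0
  rw [e.map_apply]
  refine (Set.Subsingleton.measure_zero (fun a ha b hb => e.injective ?_) _)
  rw [show e a = ξ from ha, show e b = ξ from hb]

/-! ### The Gromov compactification is orbital -/

theorem isGroupCompactification_gromovTopology (hΓ : ¬ IsElementary Γ) :
    IsGroupCompactification (gromovTopology S) where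
  compact_boundary := inferInstance
  metrizable_boundary := inferInstance
  minimal_boundary := isMinimal_boundary hΓ
  compact := (inferInstance : CompactSpace (Γ ⊕ Boundary S))
  hausdorff := (inferInstance : T2Space (Γ ⊕ Boundary S))
  dense := denseRange_inl
  induced_group := by
    refine eq_bot_of_singletons_open fun g => ?_
    refine ⟨{Sum.inl g}, isOpen_singleton_inl g, ?_⟩
    ext h
    simp
  induced_boundary := rfl
  continuous_smul := continuous_smul_gromovTopology S

theorem tendsto_translate {ν : ProbabilityMeasure (Boundary S)}
    (hν : ∀ ξ, (ν : Measure (Boundary S)) {ξ} = 0) {γ : ℕ → Γ} {ζ η : Boundary S}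
    (hγ : Tendsto (fun n => (Sum.inl (γ n) : Γ ⊕ Boundary S)) atTop (𝓝 (Sum.inr ζ)))
    (hγ' : Tendsto (fun n => (Sum.inl (γ n)⁻¹ : Γ ⊕ Boundary S)) atTop (𝓝 (Sum.inr η))) :
    Tendsto (fun n => translate (γ n) ν) atTop (𝓝 (diracProba ζ)) := by
  refine ProbabilityMeasure.tendsto_iff_forall_integral_tendsto.2 fun f => ?_
  have h1 : ∀ g : Γ, ∫ z, f z ∂(translate g ν : Measure (Boundary S)) =
      ∫ z, f (g • z) ∂(ν : Measure (Boundary S)) := fun g =>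
    integral_map (continuous_const_smul g).measurable.aemeasurable
      f.continuous.aestronglyMeasurable
  have h2 : ∫ z, f z ∂(diracProba ζ : Measure (Boundary S)) =
      ∫ _, f ζ ∂(ν : Measure (Boundary S)) := by
    simp [diracProba]
  simp only [h1, h2]
  refine tendsto_integral_filter_of_dominated_convergence (fun _ => ‖f‖)
    (Eventually.of_forall fun n => ?_) (Eventually.of_forall fun n => ?_) (integrable_const _) ?_
  · exact (f.continuous.comp (continuous_const_smul (γ n))).aestronglyMeasurable
  · exact Eventually.of_forall fun z => f.norm_coe_le_norm _
  · have hae : ∀ᵐ z ∂(ν : Measure (Boundary S)), z ≠ η := by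
      rw [ae_iff]; simpa using hν η
    filter_upwards [hae] with z hz
    exact (f.continuous.tendsto ζ).comp (tendsto_smul_of_ne hγ hγ' hz)

theorem isClosed_orbitalTopology_iff {X : Type*} [TopologicalSpace X] [MulAction Γ X]
    [ContinuousConstSMul Γ X] [MeasurableSpace X] [BorelSpace X] {ν : ProbabilityMeasure X}
    {A : Set (Γ ⊕ X)} : IsClosed[orbitalTopology ν] A ↔ IsOrbitalClosed ν A := by
  rw [← @isOpen_compl_iff _ _ (orbitalTopology ν)]
  change Aᶜᶜ ∈ {A | IsOrbitalClosed ν A} ↔ _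
  rw [compl_compl]; rfl

theorem gromovTopology_eq_orbitalTopology {ν : ProbabilityMeasure (Boundary S)}
    (hν : ∀ ξ, (ν : Measure (Boundary S)) {ξ} = 0) : gromovTopology S = orbitalTopology ν := by
  refine TopologicalSpace.ext_isClosed fun A => ?_
  rw [isClosed_orbitalTopology_iff]
  constructor
  · intro hA
    have hA' : IsClosed A := hA
    refine ⟨hA'.preimage (isEmbedding_inr (S := S)).continuous, fun γ hγA hγ x hx => ?_⟩
    -- Along a subsequence the translates tend to `δ_x`, and along a further one also to `δ_ζ` with
    -- `γ → ζ`; hence `x = ζ`.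
    obtain ⟨ψ, hψ, hx⟩ := hx.tendsto_subseq
    obtain ⟨ζ, φ, hφ, hζ⟩ := exists_subseq_tendsto (S := S) (hγ.comp hψ.tendsto_atTop)
    obtain ⟨η, χ, hχ, hη⟩ := exists_subseq_tendsto (S := S)
      (tendsto_inv_cofinite ((hγ.comp hψ.tendsto_atTop).comp hφ.tendsto_atTop))
    have h1 := tendsto_translate hν (hζ.comp hχ.tendsto_atTop) hη
    have h2 := hx.comp (hφ.comp hχ).tendsto_atTop
    obtain rfl : x = ζ := injective_diracProba (tendsto_nhds_unique h2 h1)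
    exact hA'.mem_of_tendsto hζ (Eventually.of_forall fun n => hγA _)
  · intro hA
    suffices IsClosed A from this
    refine isClosed_of_closure_subset fun p hp => ?_
    rcases p with g | ξ
    · obtain ⟨q, hq, hqA⟩ := mem_closure_iff.1 hp _ (isOpen_singleton_inl g) rfl
      rwa [← Set.mem_singleton_iff.1 hq]
    · obtain ⟨p, hpA, hp⟩ := mem_closure_iff_seq_limit.1 hp
      -- Either infinitely many terms lie on the boundary, where closedness of `A ∩ ∂Γ` suffices, or
      -- a tail lies in `Γ`, where the sequence condition applies.
      by_cases hfr : ∃ᶠ n in atTop, ∃ ζ, p n = Sum.inr ζ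
      · obtain ⟨φ, hφ, h⟩ := extraction_of_frequently_atTop hfr
        choose z hz using h
        have h1 : Tendsto z atTop (𝓝 ξ) := by
          rw [← tendsto_inr_iff_boundary]
          exact (hp.comp hφ.tendsto_atTop).congr hz
        refine hA.1.mem_of_tendsto h1 (Eventually.of_forall fun n => ?_)
        rw [Set.mem_preimage, ← hz]
        exact hpA _
      · obtain ⟨N, hN⟩ := eventually_atTop.1 (not_frequently.1 hfr)
        have h1 : ∀ n, ∃ g, p (n + N) = Sum.inl g := fun n => by
          rcases h : p (n + N) with g | ζ
          · exact ⟨g, rfl⟩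
          · exact (hN (n + N) (Nat.le_add_left _ _) ⟨ζ, h⟩).elim
        choose γ hγ using h1
        have h2 := (hp.comp (tendsto_add_atTop_nat N)).congr hγ
        have hcof := tendsto_cofinite_of_tendsto h2
        obtain ⟨η, φ, hφ, hη⟩ := exists_subseq_tendsto (S := S) (tendsto_inv_cofinite hcof)
        have h3 := tendsto_translate hν (h2.comp hφ.tendsto_atTop) hη
        refine hA.2 (fun n => γ (φ n)) (fun n => ?_) (hcof.comp hφ.tendsto_atTop) ξ h3.mapClusterPt
        rw [← hγ]
        exact hpA _

/-! ### Dirac measures and retractions -/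

/-- For a conical sequence, `{γ n} ∪ {ξ}` is closed in `τ_G`, but a closed set of `τ_{δ_{x₀}}`
containing all `γ n` must contain `ζ = lim γ n • x₀`. -/
theorem not_isPointOrbital_gromovTopology : ¬ IsPointOrbital (gromovTopology S) := by
  rintro ⟨x₀, -, h⟩
  obtain ⟨γ, ξ, ζ, hne, hγ, hγx⟩ := exists_tendsto_smul_ne x₀
  have hA : IsClosed (insert (Sum.inr ξ) (Set.range fun n => (Sum.inl (γ n) : Γ ⊕ Boundary S))) :=
    hγ.isCompact_insert_range.isClosed
  have hA' : IsOrbitalClosed (diracProba x₀)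
      (insert (Sum.inr ξ) (Set.range fun n => (Sum.inl (γ n) : Γ ⊕ Boundary S))) := by
    rw [← isClosed_orbitalTopology_iff, ← h]
    exact hA
  have htr : ∀ g : Γ, translate g (diracProba x₀) = diracProba (g • x₀) := fun g => by
    refine Subtype.ext ?_
    exact Measure.map_dirac' (continuous_const_smul g).measurable x₀
  have h1 := hA'.2 γ (fun n => Or.inr ⟨n, rfl⟩) (tendsto_cofinite_of_tendsto hγ) ζ <| by
    simp only [htr]
    exact ((continuous_diracProba.tendsto ζ).comp hγx).mapClusterPt
  rcases h1 with h1 | ⟨n, h1⟩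
  · exact hne (Sum.inr_injective h1)
  · cases h1

/-- Equivariance gives `φ (γ n) = γ n • φ 1`, so `γ n → ξ` would force `γ n • φ 1 → ξ`, against
conicality of `φ 1`. -/
theorem not_isEquivariantRetraction_gromovTopology (φ : Γ ⊕ Boundary S → Boundary S) :
    ¬ IsEquivariantRetraction (gromovTopology S) φ := by
  rintro ⟨hc, hid, heq⟩
  have hc' : Continuous φ := hc
  obtain ⟨γ, ξ, ζ, hne, hγ, hγx⟩ := exists_tendsto_smul_ne (φ (Sum.inl 1))
  have h1 := (hc'.tendsto _).comp hγ
  rw [hid] at h1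
  refine hne (tendsto_nhds_unique hγx (h1.congr fun n => ?_))
  rw [← heq]
  exact congrArg φ (congrArg Sum.inl (mul_one (γ n)).symm)

end Minimality

end GromovCompactification

theorem theorem1p1 {Γ : Type*} [Group Γ] (S : GromovCompactification.HyperbolicGeneratingSet Γ)
    (hΓ : ¬ GromovCompactification.IsElementary Γ) :
    GromovCompactification.IsOrbital (GromovCompactification.gromovTopology S) ∧
    (∀ ν : ProbabilityMeasure (GromovCompactification.Boundary S),
      (∀ ξ : GromovCompactification.Boundary S,
        (ν : Measure (GromovCompactification.Boundary S)) {ξ} = 0) →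
      GromovCompactification.gromovTopology S = GromovCompactification.orbitalTopology ν) ∧
    ¬ GromovCompactification.IsPointOrbital (GromovCompactification.gromovTopology S) ∧
    ¬ ∃ φ : Γ ⊕ GromovCompactification.Boundary S → GromovCompactification.Boundary S,
      GromovCompactification.IsEquivariantRetraction (GromovCompactification.gromovTopology S) φ := by
  obtain ⟨ν, hν⟩ := GromovCompactification.exists_nonatomic (S := S) hΓ
  exact ⟨⟨ν, GromovCompactification.isGroupCompactification_gromovTopology hΓ,
      GromovCompactification.gromovTopology_eq_orbitalTopology hν⟩,
    fun _ h => GromovCompactification.gromovTopology_eq_orbitalTopology h,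
    GromovCompactification.not_isPointOrbital_gromovTopology,
    fun ⟨φ, hφ⟩ => GromovCompactification.not_isEquivariantRetraction_gromovTopology φ hφ⟩
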